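/- Let $D\subseteq\mathbb{C}$ be a domain (a nonempty connected open set) and $F$ an analytic function in $D$. Let $\gamma_1,\dots,\gamma_\ell$ be distinct complex numbers, let $t_1,\dots,t_\ell$ be positive integers, and set $d=t_1+\cdots+t_\ell$. Let $\Gamma$ be a positively oriented rectifiable simple closed curve (given by an absolutely continuous parametrization on $[0,1]$) such that $\Gamma$ and its inside are contained in $D$ and the points $\gamma_1,\dots,\gamma_\ell$ lie inside $\Gamma$. Here the inside of $\Gamma$ is the bounded component of $\mathbb{C}\setminus\Gamma$, and positively oriented means that $\Gamma$ has winding number $1$ around every point inside it. Then there is a unique polynomial $f\in\mathbb{C}[z]$ of degree $<d$ such that $$\frac{\mathrm{d}^i f}{\mathrm{d}z^i}(\gamma_j)=\frac{\mathrm{d}^i F}{\mathrm{d}z^i}(\gamma_j)\qquad(1\le j\le\ell,\ 0\le i\le t_j-1),$$ and for every $z$ inside $\Gamma$ this polynomial is given by $$f(z)=F(z)+\frac{1}{2\pi i}\int_\Gamma\Phi(\zeta)\,\mathrm{d}\zeta,\qquad \Phi(\zeta)=\frac{F(\zeta)}{z-\zeta}\prod_{j=1}^{\ell}\left(\frac{z-\gamma_j}{\zeta-\gamma_j}\right)^{t_j},$$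 where the integral exists. -/

import Mathlib

/-- The contour integral `∫_Γ f(ζ) dζ`, i.e. the integral along `Γ` of the 1-form `f(ζ) dζ`. -/
noncomputable def contourIntegral {a b : ℂ} (Γ : Path a b) (f : ℂ → ℂ) : ℂ :=
  curveIntegral (fun ζ => ContinuousLinearMap.toSpanSingleton ℂ (f ζ)) Γ

/-- The integral `∫_Γ f(ζ) dζ` exists: `t ↦ f(Γ(t)) Γ'(t)` is Lebesgue integrable. -/
def ContourIntegrable {a b : ℂ} (Γ : Path a b) (f : ℂ → ℂ) : Prop :=
  CurveIntegrable (fun ζ => ContinuousLinearMap.toSpanSingleton ℂ (f ζ)) Γ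

/-- The winding number of the closed curve `Γ` around `w`. -/
noncomputable def windingNumber {a : ℂ} (Γ : Path a a) (w : ℂ) : ℂ :=
  (1 / (2 * Real.pi * Complex.I)) * contourIntegral Γ (fun ζ => 1 / (ζ - w))

/-- The inside of a closed curve: the union of the bounded components of the complement of its
trace (for a simple closed curve there is exactly one such component). -/
def curveInside {a : ℂ} (Γ : Path a a) : Set ℂ :=
  {w | w ∉ Set.range Γ ∧ Bornology.IsBounded (connectedComponentIn (Set.range Γ)ᶜ w)}

/-- A positively oriented simple closed rectifiable curve, given by an absolutely continuous
parametrization. Piecewise `C¹` parametrizations are absolutely continuous, and so is the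
constant speed parametrization of any rectifiable curve. -/
structure IsPositiveSimpleClosedCurve {a : ℂ} (Γ : Path a a) : Prop where
  /-- No two parameters have the same image, except that both endpoints are sent to `a`. -/
  simple : Set.InjOn Γ {t | t ≠ 1}
  absolutelyContinuous : AbsolutelyContinuousOnInterval Γ.extend 0 1
  /-- The curve winds once, counterclockwise, around the points inside it. -/
  positive : ∀ w ∈ curveInside Γ, windingNumber Γ w = 1

/-- `f` is a polynomial of degree `< t₁ + ⋯ + t_ℓ` whose derivatives of order `i < t_j` at `γ_j`
are those of `F`. -/
def IsHermiteInterpolant {l : ℕ} (F : ℂ → ℂ) (γ : Fin l → ℂ) (t : Fin l → ℕ)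
    (f : Polynomial ℂ) : Prop :=
  f.degree < ((∑ j, t j : ℕ) : WithBot ℕ) ∧
    ∀ j, ∀ i < t j, iteratedDeriv i (fun x => f.eval x) (γ j) = iteratedDeriv i F (γ j)

/-- The integrand `Φ(ζ) = F(ζ) / (z - ζ) * ∏_j ((z - γ_j) / (ζ - γ_j)) ^ t_j`. -/
noncomputable def hermiteKernel {l : ℕ} (F : ℂ → ℂ) (γ : Fin l → ℂ) (t : Fin l → ℕ)
    (z ζ : ℂ) : ℂ :=
  F ζ / (z - ζ) * ∏ j, ((z - γ j) / (ζ - γ j)) ^ t j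

/-!
Write `P = ∏ j, (X - γ j) ^ t j`. Newton interpolation, one difference quotient for each node counted
with multiplicity, gives `F = f + P * G` with `f` a polynomial of degree `< deg P` and `G`
holomorphic in `D` (`exists_newton_expansion`). As `F - f` vanishes to order `t j` at `γ j`, this `f` is the
interpolant; two interpolants differ by a multiple of `P` of smaller degree, so it is the only one.

On the curve the kernel is `-P(z) * (f(ζ) / ((ζ - z) * P(ζ)) + G(ζ) / (ζ - z))`. The first summand
is a rational function that decays like `1 / ζ ^ 2` and around all of whose poles the curve winds
equally often, so its integral is zero (`contourIntegral_polynomial_div_prod_eq_zero`). The second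
one gives `2πi * G(z)` by Cauchy's integral formula (`contourIntegral_cauchy`), and
`F(z) - P(z) * G(z) = f(z)`.

Cauchy's formula for a rectifiable curve is proved by Dixon's method
(`contourIntegral_dslope_eq_zero`). It needs that the curve does not wind around the points outside
`D`. Such a point lies in an unbounded component of the complement of the curve; the winding number
is constant on that component, its derivative being the integral of a function with a primitive,
and it tends to zero at infinity. The Jordan curve theorem plays no role. Primitives are integrated
along the curve by the fundamental theorem of calculus for absolutely continuous functions.
-/

namespace HermiteContour

open MeasureTheory Set Filter Topology
open scoped NNReal

/-! ### Absolutely continuous functions with complex values -/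

theorem absolutelyContinuousOnInterval_comp_of_lipschitzOnWith {X Y : Type*}
    [PseudoMetricSpace X] [PseudoMetricSpace Y] {c : ℝ → X} {G : X → Y} {K : ℝ≥0} {s : Set X}
    {p q : ℝ} (hG : LipschitzOnWith K G s) (hc : AbsolutelyContinuousOnInterval c p q)
    (hcs : MapsTo c (uIcc p q) s) : AbsolutelyContinuousOnInterval (G ∘ c) p q := by
  rw [absolutelyContinuousOnInterval_iff] at hc ⊢
  intro ε hε
  obtain ⟨δ, hδ, h⟩ := hc (ε / (K + 1)) (by positivity)
  refine ⟨δ, hδ, fun E hE hlt => ?_⟩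
  calc ∑ i ∈ Finset.range E.1, dist ((G ∘ c) (E.2 i).1) ((G ∘ c) (E.2 i).2)
      ≤ ∑ i ∈ Finset.range E.1, K * dist (c (E.2 i).1) (c (E.2 i).2) :=
        Finset.sum_le_sum fun i hi =>
          hG.dist_le_mul _ (hcs (hE.1 i hi).1) _ (hcs (hE.1 i hi).2)
    _ = K * ∑ i ∈ Finset.range E.1, dist (c (E.2 i).1) (c (E.2 i).2) :=
        (Finset.mul_sum _ _ _).symm
    _ ≤ K * (ε / (K + 1)) := by gcongr; exact (h E hE hlt).le
    _ < (K + 1) * (ε / (K + 1)) := by gcongr; linarith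
    _ = ε := by field

section

variable {c : ℝ → ℂ} {p q : ℝ}

theorem absolutelyContinuousOnInterval_re (hc : AbsolutelyContinuousOnInterval c p q) :
    AbsolutelyContinuousOnInterval (fun t => (c t).re) p q :=
  absolutelyContinuousOnInterval_comp_of_lipschitzOnWith
    (Complex.reCLM.lipschitz.lipschitzOnWith (s := univ)) hc (mapsTo_univ _ _)

theorem absolutelyContinuousOnInterval_im (hc : AbsolutelyContinuousOnInterval c p q) :
    AbsolutelyContinuousOnInterval (fun t => (c t).im) p q :=
  absolutelyContinuousOnInterval_comp_of_lipschitzOnWith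
    (Complex.imCLM.lipschitz.lipschitzOnWith (s := univ)) hc (mapsTo_univ _ _)

theorem ae_differentiableAt_of_absolutelyContinuous
    (hc : AbsolutelyContinuousOnInterval c p q) :
    ∀ᵐ t, t ∈ uIcc p q → DifferentiableAt ℝ c t :=
  hc.boundedVariationOn.ae_differentiableAt_of_mem_uIcc

theorem ae_re_deriv_eq (hc : AbsolutelyContinuousOnInterval c p q) :
    ∀ᵐ t, t ∈ uIoc p q → deriv (fun t => (c t).re) t = (deriv c t).re := by
  filter_upwards [ae_differentiableAt_of_absolutelyContinuous hc] with t ht hm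
  exact ((Complex.reCLM.hasFDerivAt.comp_hasDerivAt t
    (ht (uIoc_subset_uIcc hm)).hasDerivAt)).deriv

theorem ae_im_deriv_eq (hc : AbsolutelyContinuousOnInterval c p q) :
    ∀ᵐ t, t ∈ uIoc p q → deriv (fun t => (c t).im) t = (deriv c t).im := by
  filter_upwards [ae_differentiableAt_of_absolutelyContinuous hc] with t ht hm
  exact ((Complex.imCLM.hasFDerivAt.comp_hasDerivAt t
    (ht (uIoc_subset_uIcc hm)).hasDerivAt)).deriv

theorem intervalIntegrable_deriv_of_absolutelyContinuous
    (hc : AbsolutelyContinuousOnInterval c p q) : IntervalIntegrable (deriv c) volume p q := by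
  have h1 := (absolutelyContinuousOnInterval_re hc).intervalIntegrable_deriv.congr_ae
    ((ae_restrict_iff' measurableSet_uIoc).2 (ae_re_deriv_eq hc))
  have h2 := (absolutelyContinuousOnInterval_im hc).intervalIntegrable_deriv.congr_ae
    ((ae_restrict_iff' measurableSet_uIoc).2 (ae_im_deriv_eq hc))
  rw [intervalIntegrable_iff] at h1 h2 ⊢
  exact (h1.ofReal.add (h2.ofReal.mul_const Complex.I)).congr
    (Eventually.of_forall fun t => Complex.re_add_im _)

theorem integral_deriv_of_absolutelyContinuous
    (hc : AbsolutelyContinuousOnInterval c p q) : ∫ t in p..q, deriv c t = c q - c p := by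
  have hi := intervalIntegrable_deriv_of_absolutelyContinuous hc
  apply Complex.ext
  · rw [Complex.sub_re, ← (absolutelyContinuousOnInterval_re hc).integral_deriv_eq_sub,
      intervalIntegral.integral_congr_ae (ae_re_deriv_eq hc)]
    exact (Complex.reCLM.intervalIntegral_comp_comm hi).symm
  · rw [Complex.sub_im, ← (absolutelyContinuousOnInterval_im hc).integral_deriv_eq_sub,
      intervalIntegral.integral_congr_ae (ae_im_deriv_eq hc)]
    exact (Complex.imCLM.intervalIntegral_comp_comm hi).symm

end

/-! ### Contour integrals along absolutely continuous curves -/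

section

variable {a b : ℂ} {Γ : Path a b} {f g : ℂ → ℂ}

theorem contourIntegral_eq (Γ : Path a b) (f : ℂ → ℂ) :
    contourIntegral Γ f = ∫ t in (0 : ℝ)..1, deriv Γ.extend t * f (Γ.extend t) := by
  rw [contourIntegral, curveIntegral_eq_intervalIntegral_deriv]
  simp

theorem extend_mem_range (Γ : Path a b) (t : ℝ) : Γ.extend t ∈ range Γ := by
  rw [← Γ.extend_range]; exact mem_range_self t

theorem contourIntegrable_iff (Γ : Path a b) (f : ℂ → ℂ) : ContourIntegrable Γ f ↔
    IntervalIntegrable (fun t => deriv Γ.extend t * f (Γ.extend t)) volume 0 1 := by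
  rw [ContourIntegrable, CurveIntegrable]
  apply intervalIntegrable_congr_ae
  rw [uIoc_of_le zero_le_one, ← restrict_Ioo_eq_restrict_Ioc]
  filter_upwards [ae_restrict_mem (by measurability)] with x hx
  rw [curveIntegralFun_def, derivWithin_of_mem_nhds (by simpa)]
  simp

theorem contourIntegrable_of_continuousOn (hΓ : AbsolutelyContinuousOnInterval Γ.extend 0 1)
    (hf : ContinuousOn f (range Γ)) : ContourIntegrable Γ f := by
  rw [contourIntegrable_iff]
  exact (intervalIntegrable_deriv_of_absolutelyContinuous hΓ).mul_continuousOn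
    (hf.comp_continuous Γ.continuous_extend (extend_mem_range Γ)).continuousOn

theorem contourIntegral_congr (h : EqOn f g (range Γ)) :
    contourIntegral Γ f = contourIntegral Γ g := by
  simp only [contourIntegral_eq, h (extend_mem_range Γ _)]

theorem contourIntegral_sub (hf : ContourIntegrable Γ f) (hg : ContourIntegrable Γ g) :
    contourIntegral Γ (fun ζ => f ζ - g ζ) = contourIntegral Γ f - contourIntegral Γ g := by
  rw [contourIntegrable_iff] at hf hg
  simp only [contourIntegral_eq, mul_sub]
  exact intervalIntegral.integral_sub hf hg

theorem contourIntegral_add (hf : ContourIntegrable Γ f) (hg : ContourIntegrable Γ g) :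
    contourIntegral Γ (fun ζ => f ζ + g ζ) = contourIntegral Γ f + contourIntegral Γ g := by
  rw [contourIntegrable_iff] at hf hg
  simp only [contourIntegral_eq, mul_add]
  exact intervalIntegral.integral_add hf hg

theorem contourIntegral_const_mul (k : ℂ) (f : ℂ → ℂ) :
    contourIntegral Γ (fun ζ => k * f ζ) = k * contourIntegral Γ f := by
  simp only [contourIntegral_eq, mul_left_comm _ k, intervalIntegral.integral_const_mul]

theorem norm_contourIntegral_le (hΓ : AbsolutelyContinuousOnInterval Γ.extend 0 1) {C : ℝ}
    (hC : ∀ ζ ∈ range Γ, ‖f ζ‖ ≤ C) :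
    ‖contourIntegral Γ f‖ ≤ (∫ t in (0 : ℝ)..1, ‖deriv Γ.extend t‖) * C := by
  rw [contourIntegral_eq, ← intervalIntegral.integral_mul_const]
  refine intervalIntegral.norm_integral_le_of_norm_le zero_le_one
    (Eventually.of_forall fun t _ => ?_)
    ((intervalIntegrable_deriv_of_absolutelyContinuous hΓ).norm.mul_const C)
  rw [norm_mul]
  exact mul_le_mul_of_nonneg_left (hC _ (extend_mem_range Γ t)) (norm_nonneg _)

/-- The fundamental theorem of calculus along an absolutely continuous curve: the primitive is
Lipschitz on the compact trace, so its composition with the curve is absolutely continuous. -/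
theorem contourIntegral_deriv (hΓ : AbsolutelyContinuousOnInterval Γ.extend 0 1) {G : ℂ → ℂ}
    {U : Set ℂ} (hU : IsOpen U) (hG : DifferentiableOn ℂ G U) (hΓU : range Γ ⊆ U) :
    contourIntegral Γ (deriv G) = G b - G a := by
  have hL : LocallyLipschitzOn (range Γ) G := by
    intro z hz
    have h1 : ContDiffAt ℂ 1 G z := (hG.analyticAt (hU.mem_nhds (hΓU hz))).contDiffAt
    obtain ⟨K, t, ht, hK⟩ := h1.exists_lipschitzOnWith
    exact ⟨K, t, mem_nhdsWithin_of_mem_nhds ht, hK⟩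
  obtain ⟨K, hK⟩ := hL.exists_lipschitzOnWith_of_compact (isCompact_range Γ.continuous)
  have hac := absolutelyContinuousOnInterval_comp_of_lipschitzOnWith hK hΓ
    fun t _ => extend_mem_range Γ t
  have h := integral_deriv_of_absolutelyContinuous hac
  simp only [Function.comp_apply, Path.extend_zero, Path.extend_one] at h
  rw [← h, contourIntegral_eq]
  apply intervalIntegral.integral_congr_ae
  filter_upwards [ae_differentiableAt_of_absolutelyContinuous hΓ] with t ht hm
  have h1 : HasDerivAt G (deriv G (Γ.extend t)) (Γ.extend t) :=
    (hG.differentiableAt (hU.mem_nhds (hΓU (extend_mem_range Γ t)))).hasDerivAt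
  rw [((h1.scomp t (ht (uIoc_subset_uIcc hm)).hasDerivAt)).deriv, smul_eq_mul]

/-- Differentiation under the contour integral. Local boundedness of the kernel is enough, since
Cauchy's estimate turns it into a local bound for the derivative. -/
theorem hasDerivAt_contourIntegral (hΓ : AbsolutelyContinuousOnInterval Γ.extend 0 1)
    {K : ℂ → ℂ → ℂ} {z₀ : ℂ} {r C : ℝ} (hr : 0 < r)
    (hd : ∀ ζ ∈ range Γ, DifferentiableOn ℂ (fun z => K z ζ) (Metric.ball z₀ r))
    (hc : ∀ z ∈ Metric.ball z₀ r, ContinuousOn (K z) (range Γ))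
    (hb : ∀ z ∈ Metric.ball z₀ r, ∀ ζ ∈ range Γ, ‖K z ζ‖ ≤ C) :
    HasDerivAt (fun z => contourIntegral Γ (K z))
      (contourIntegral Γ fun ζ => deriv (fun z => K z ζ) z₀) z₀ := by
  simp only [contourIntegral_eq]
  have hci := intervalIntegrable_deriv_of_absolutelyContinuous hΓ
  have hint : ∀ z ∈ Metric.ball z₀ r,
      IntervalIntegrable (fun t => deriv Γ.extend t * K z (Γ.extend t)) volume 0 1 := fun z hz =>
    (contourIntegrable_iff _ _).1 (contourIntegrable_of_continuousOn hΓ (hc z hz))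
  have hz₀ : z₀ ∈ Metric.ball z₀ r := Metric.mem_ball_self hr
  have hmeas : ∀ z ∈ Metric.ball z₀ r, AEStronglyMeasurable
      (fun t => deriv Γ.extend t * K z (Γ.extend t)) (volume.restrict (uIoc 0 1)) :=
    fun z hz => (intervalIntegrable_iff.1 (hint z hz)).aestronglyMeasurable
  have hder : ∀ t, ∀ z ∈ Metric.ball z₀ r, HasDerivAt
      (fun z => deriv Γ.extend t * K z (Γ.extend t))
      (deriv Γ.extend t * deriv (fun z => K z (Γ.extend t)) z) z := fun t z hz =>
    (((hd _ (extend_mem_range Γ t)).differentiableAt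
      (Metric.isOpen_ball.mem_nhds hz)).hasDerivAt).const_mul _
  refine (intervalIntegral.hasDerivAt_integral_of_dominated_loc_of_deriv_le
    (s := Metric.ball z₀ (r / 2)) (bound := fun t => ‖deriv Γ.extend t‖ * (C / (r / 2)))
    (F' := fun z t => deriv Γ.extend t * deriv (fun z => K z (Γ.extend t)) z)
    (Metric.ball_mem_nhds _ (by positivity)) ?_ (hint z₀ hz₀) ?_ ?_ (hci.norm.mul_const _) ?_).2
  · filter_upwards [Metric.ball_mem_nhds z₀ hr] with z hz using hmeas z hz
  · -- measurability: the derivative is a pointwise limit of difference quotients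
    obtain ⟨u, hu0, hu⟩ : ∃ u : ℕ → ℂ, (∀ n, u n ∈ Metric.ball (0 : ℂ) r) ∧
        Tendsto u atTop (𝓝[≠] 0) := by
      obtain ⟨v, hv⟩ := exists_seq_tendsto (𝓝[≠] (0 : ℂ))
      obtain ⟨N, hN⟩ := eventually_atTop.1 (hv.eventually
        (mem_nhdsWithin_of_mem_nhds (Metric.ball_mem_nhds (0 : ℂ) hr)))
      exact ⟨fun n => v (n + N), fun n => hN _ (Nat.le_add_left _ _),
        hv.comp (tendsto_add_atTop_nat N)⟩
    refine aestronglyMeasurable_of_tendsto_ae atTop (f := fun n t => (u n)⁻¹ •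
      (deriv Γ.extend t * K (z₀ + u n) (Γ.extend t) - deriv Γ.extend t * K z₀ (Γ.extend t)))
      (fun n => ?_) (Eventually.of_forall fun t => ?_)
    · exact AEStronglyMeasurable.const_smul
        ((hmeas (z₀ + u n) (by simpa using hu0 n)).sub (hmeas _ hz₀)) (u n)⁻¹
    · exact ((hasDerivAt_iff_tendsto_slope_zero.1 (hder t z₀ hz₀))).comp hu
  · refine Eventually.of_forall fun t _ z hz => ?_
    rw [norm_mul]
    refine mul_le_mul_of_nonneg_left ?_ (norm_nonneg _)
    -- Cauchy's estimate on a disc of radius `r / 2` around `z`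
    have hsub : Metric.closedBall z (r / 2) ⊆ Metric.ball z₀ r := fun w hw => by
      rw [Metric.mem_closedBall] at hw
      rw [Metric.mem_ball] at hz ⊢
      linarith [dist_triangle w z z₀]
    refine Complex.norm_deriv_le_of_forall_mem_sphere_norm_le (by positivity) ?_
      fun w hw => hb w (hsub (Metric.sphere_subset_closedBall hw)) _ (extend_mem_range Γ t)
    exact ((hd _ (extend_mem_range Γ t)).mono hsub).diffContOnCl_ball subset_rfl
  · exact Eventually.of_forall fun t _ z hz =>
      hder t z (Metric.ball_subset_ball (by linarith) hz)

end

/-! ### Cauchy transforms and winding numbers -/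

section

variable {a b : ℂ} {Γ : Path a b} {φ : ℂ → ℂ}

theorem isOpen_compl_range (Γ : Path a b) : IsOpen (range Γ)ᶜ :=
  (isCompact_range Γ.continuous).isClosed.isOpen_compl

theorem continuousOn_div_sub (hφ : ContinuousOn φ (range Γ)) {z : ℂ} (hz : z ∉ range Γ) :
    ContinuousOn (fun ζ => φ ζ / (ζ - z)) (range Γ) :=
  hφ.div (by fun_prop) fun ζ hζ => sub_ne_zero.2 fun h => hz (h ▸ hζ)

theorem hasDerivAt_cauchyTransform (hΓ : AbsolutelyContinuousOnInterval Γ.extend 0 1)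
    (hφ : ContinuousOn φ (range Γ)) {z : ℂ} (hz : z ∉ range Γ) :
    HasDerivAt (fun w => contourIntegral Γ fun ζ => φ ζ / (ζ - w))
      (contourIntegral Γ fun ζ => φ ζ / (ζ - z) ^ 2) z := by
  have hK := isCompact_range Γ.continuous
  obtain ⟨r, hr, hsub⟩ := Metric.isOpen_iff.1 (isOpen_compl_range Γ) z hz
  obtain ⟨M, hM⟩ := hK.exists_bound_of_continuousOn hφ
  have hne : ∀ w ∈ Metric.ball z r, ∀ ζ ∈ range Γ, ζ - w ≠ 0 := fun w hw ζ hζ h =>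
    hsub hw (sub_eq_zero.1 h ▸ hζ)
  have hbs : Metric.ball z (r / 2) ⊆ Metric.ball z r := Metric.ball_subset_ball (by linarith)
  have hder : ∀ w ∈ Metric.ball z r, ∀ ζ ∈ range Γ,
      HasDerivAt (fun w => φ ζ / (ζ - w)) (φ ζ / (ζ - w) ^ 2) w := fun w hw ζ hζ => by
    have h1 : HasDerivAt (fun w => ζ - w) (-1) w := (hasDerivAt_id w).const_sub ζ
    convert! (hasDerivAt_const w (φ ζ)).div h1 (hne w hw ζ hζ) using 1
    ring
  have h := hasDerivAt_contourIntegral (K := fun w ζ => φ ζ / (ζ - w)) (C := M / (r / 2)) hΓ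
    (half_pos hr)
    (fun ζ hζ w hw => (hder w (hbs hw) ζ hζ).differentiableAt.differentiableWithinAt)
    (fun w hw => continuousOn_div_sub hφ (hsub (hbs hw))) fun w hw ζ hζ => by
      have h1 : r ≤ dist ζ z := by
        by_contra! h
        exact hsub (Metric.mem_ball.2 h) hζ
      have h2 : r / 2 ≤ ‖ζ - w‖ := by
        rw [← dist_eq_norm]
        linarith [dist_triangle ζ w z, Metric.mem_ball.1 hw]
      rw [norm_div]
      exact div_le_div₀ ((norm_nonneg _).trans (hM ζ hζ)) (hM ζ hζ) (half_pos hr) h2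
  convert! h using 1
  exact contourIntegral_congr fun ζ hζ => (hder z (Metric.mem_ball_self hr) ζ hζ).deriv.symm

/-- A Cauchy transform vanishes at infinity. -/
theorem tendsto_cauchyTransform (hΓ : AbsolutelyContinuousOnInterval Γ.extend 0 1)
    (hφ : ContinuousOn φ (range Γ)) :
    Tendsto (fun w => contourIntegral Γ fun ζ => φ ζ / (ζ - w)) (cocompact ℂ) (𝓝 0) := by
  have hK := isCompact_range Γ.continuous
  obtain ⟨M, hM⟩ := hK.exists_bound_of_continuousOn hφ
  obtain ⟨R, hR⟩ := hK.exists_bound_of_continuousOn continuousOn_id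
  set L := ∫ t in (0 : ℝ)..1, ‖deriv Γ.extend t‖
  have hlim : Tendsto (fun w : ℂ => L * (M / (‖w‖ - R))) (cocompact ℂ) (𝓝 0) := by
    have h1 : Tendsto (fun w : ℂ => ‖w‖ - R) (cocompact ℂ) atTop :=
      tendsto_atTop_add_const_right _ (-R) (tendsto_norm_cocompact_atTop (E := ℂ))
    simpa using (h1.const_div_atTop M).const_mul L
  refine squeeze_zero_norm' ?_ hlim
  filter_upwards [(tendsto_norm_cocompact_atTop (E := ℂ)).eventually_gt_atTop R] with w hw
  refine norm_contourIntegral_le hΓ fun ζ hζ => ?_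
  rw [norm_div]
  refine div_le_div₀ ((norm_nonneg _).trans (hM ζ hζ)) (hM ζ hζ) (sub_pos.2 hw) ?_
  rw [norm_sub_rev]
  linarith [norm_sub_norm_le w ζ, show ‖ζ‖ ≤ R from hR ζ hζ]

end

section

variable {a : ℂ} {Γ : Path a a}

/-- The integral of `1 / (ζ - w) ^ (n + 2)` along a closed curve vanishes, as the integrand has a
primitive. -/
theorem contourIntegral_inv_pow_eq_zero (hΓ : AbsolutelyContinuousOnInterval Γ.extend 0 1)
    {w : ℂ} (hw : w ∉ range Γ) (n : ℕ) :
    contourIntegral Γ (fun ζ => 1 / (ζ - w) ^ (n + 2)) = 0 := by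
  have hder : ∀ ζ, ζ ≠ w → HasDerivAt (fun ζ => ((ζ - w) ^ (n + 1))⁻¹)
      (-(n + 1) * (1 / (ζ - w) ^ (n + 2))) ζ := fun ζ hζ => by
    have h0 : ζ - w ≠ 0 := sub_ne_zero.2 hζ
    convert! (((hasDerivAt_id ζ).sub_const w).pow (n + 1)).inv (pow_ne_zero _ h0) using 1
    simp only [id, Pi.pow_apply, Nat.add_sub_cancel, Nat.cast_add, Nat.cast_one, mul_one]
    field_simp
    ring
  have h := contourIntegral_deriv hΓ (isOpen_compl_singleton (x := w))
    (fun ζ hζ => (hder ζ hζ).differentiableAt.differentiableWithinAt)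
    (subset_compl_singleton_iff.2 hw)
  rw [sub_self, contourIntegral_congr (g := fun ζ => -(n + 1) * (1 / (ζ - w) ^ (n + 2)))
    (fun ζ hζ => (hder ζ fun h => hw (h ▸ hζ)).deriv), contourIntegral_const_mul] at h
  refine (mul_eq_zero.1 h).resolve_left (neg_ne_zero.2 ?_)
  exact_mod_cast n.succ_ne_zero

/-- The integral defining the winding number is constant on the components of the complement: its
derivative is the integral of `1 / (ζ - w) ^ 2`. -/
theorem contourIntegral_inv_sub_eq_of_mem_component
    (hΓ : AbsolutelyContinuousOnInterval Γ.extend 0 1) {z w : ℂ}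
    (hw : w ∈ connectedComponentIn (range Γ)ᶜ z) :
    contourIntegral Γ (fun ζ => 1 / (ζ - w)) = contourIntegral Γ (fun ζ => 1 / (ζ - z)) := by
  have hz : z ∈ (range Γ)ᶜ := connectedComponentIn_nonempty_iff.1 ⟨w, hw⟩
  have hder : ∀ u ∈ connectedComponentIn (range Γ)ᶜ z,
      HasDerivAt (fun w => contourIntegral Γ fun ζ => 1 / (ζ - w)) 0 u := fun u hu => by
    have hu' : u ∉ range Γ := connectedComponentIn_subset _ _ hu
    have h := hasDerivAt_cauchyTransform (φ := fun _ => 1) hΓ continuousOn_const hu'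
    rwa [contourIntegral_inv_pow_eq_zero hΓ hu' 0] at h
  exact (isOpen_compl_range Γ).connectedComponentIn.is_const_of_deriv_eq_zero
    isPreconnected_connectedComponentIn
    (fun u hu => (hder u hu).differentiableAt.differentiableWithinAt)
    (fun u hu => (hder u hu).deriv) hw (mem_connectedComponentIn hz)

/-- A closed curve does not wind around the points of unbounded components. -/
theorem contourIntegral_inv_sub_eq_zero (hΓ : AbsolutelyContinuousOnInterval Γ.extend 0 1)
    {z : ℂ} (hz : ¬ Bornology.IsBounded (connectedComponentIn (range Γ)ᶜ z)) :
    contourIntegral Γ (fun ζ => 1 / (ζ - z)) = 0 := by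
  by_contra h0
  have h := (tendsto_cauchyTransform (φ := fun _ => 1) hΓ continuousOn_const).eventually_ne
    (Ne.symm h0)
  rw [← Metric.cobounded_eq_cocompact] at h
  refine hz (Bornology.isBounded_def.2 (mem_of_superset h fun w hw hwz => ?_))
  exact hw (contourIntegral_inv_sub_eq_of_mem_component hΓ hwz)

/-- Points of large modulus lie on a ray that avoids the curve, so their component is unbounded. -/
theorem eventually_not_isBounded_component (Γ : Path a a) :
    ∀ᶠ z in cocompact ℂ, z ∉ range Γ ∧
      ¬ Bornology.IsBounded (connectedComponentIn (range Γ)ᶜ z) := by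
  obtain ⟨R, hR⟩ := (isCompact_range Γ.continuous).exists_bound_of_continuousOn continuousOn_id
  have hR0 : 0 ≤ R := (norm_nonneg _).trans (hR _ (mem_range_self 0))
  filter_upwards [(tendsto_norm_cocompact_atTop (E := ℂ)).eventually_gt_atTop R] with z hz
  have hray : ∀ s ∈ Ici (1 : ℝ), s • z ∈ (range Γ)ᶜ := fun s hs hm => by
    have h1 : ‖s • z‖ ≤ R := hR _ hm
    rw [norm_smul, Real.norm_of_nonneg (zero_le_one.trans hs)] at h1
    nlinarith [mem_Ici.1 hs, norm_nonneg z]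
  have hsub : (fun s : ℝ => s • z) '' Ici 1 ⊆ connectedComponentIn (range Γ)ᶜ z :=
    (isPreconnected_Ici.image _ (by fun_prop)).subset_connectedComponentIn
      ⟨1, self_mem_Ici, one_smul _ _⟩ (image_subset_iff.2 hray)
  refine ⟨by simpa using hray 1 self_mem_Ici, fun hb => ?_⟩
  obtain ⟨B, hB⟩ := hb.exists_norm_le
  have hz0 : 0 < ‖z‖ := hR0.trans_lt hz
  -- this multiple of `z` has modulus at least `B + 1`
  have h1 := hB _ (hsub ⟨max 1 ((B + 1) / ‖z‖), mem_Ici.2 (le_max_left _ _), rfl⟩)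
  rw [norm_smul, Real.norm_of_nonneg (zero_le_one.trans (le_max_left _ _))] at h1
  have h2 := mul_le_mul_of_nonneg_right (le_max_right 1 ((B + 1) / ‖z‖)) hz0.le
  rw [div_mul_cancel₀ _ hz0.ne'] at h2
  linarith

end

/-! ### Cauchy's integral formula -/

/-- The difference quotient is symmetric in its two points. -/
theorem dslope_comm (F : ℂ → ℂ) (z w : ℂ) : dslope F z w = dslope F w z := by
  by_cases h : w = z
  · rw [h]
  · rw [dslope_of_ne _ h, dslope_of_ne _ (Ne.symm h), slope_comm]

/-- Difference quotients of a holomorphic function are locally bounded in one variable, uniformly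
for the other variable in a compact set: close to the diagonal by the mean value inequality, away
from it because the denominator is bounded below. -/
theorem exists_dslope_bound {D S : Set ℂ} (hD : IsOpen D) {F : ℂ → ℂ}
    (hF : DifferentiableOn ℂ F D) (hS : IsCompact S) (hSD : S ⊆ D) {z₀ : ℂ} (hz₀ : z₀ ∈ D) :
    ∃ r > 0, ∃ C, Metric.ball z₀ r ⊆ D ∧
      ∀ z ∈ Metric.ball z₀ r, ∀ ζ ∈ S, ‖dslope F z ζ‖ ≤ C := by
  obtain ⟨ρ, hρ, hρD⟩ := Metric.nhds_basis_closedBall.mem_iff.1 (hD.mem_nhds hz₀)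
  have hcF : ContinuousOn F D := hF.continuousOn
  obtain ⟨M₁, hM₁⟩ := (isCompact_closedBall z₀ ρ).exists_bound_of_continuousOn (hcF.mono hρD)
  obtain ⟨M₂, hM₂⟩ := hS.exists_bound_of_continuousOn (hcF.mono hSD)
  obtain ⟨M₃, hM₃⟩ := (isCompact_closedBall z₀ ρ).exists_bound_of_continuousOn
    ((hF.deriv hD).continuousOn.mono hρD)
  refine ⟨ρ / 2, half_pos hρ, max M₃ ((M₂ + M₁) / (ρ / 2)),
    (Metric.ball_subset_closedBall.trans (Metric.closedBall_subset_closedBall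
      (by linarith))).trans hρD, fun z hz ζ hζ => ?_⟩
  have hz' : z ∈ Metric.closedBall z₀ ρ :=
    Metric.closedBall_subset_closedBall (by linarith) (Metric.ball_subset_closedBall hz)
  by_cases hzζ : ζ = z
  · rw [hzζ, dslope_same]
    exact (hM₃ z hz').trans (le_max_left _ _)
  have hpos : 0 < ‖ζ - z‖ := norm_pos_iff.2 (sub_ne_zero.2 hzζ)
  rw [dslope_of_ne _ hzζ, slope_def_field, norm_div]
  by_cases hζρ : ζ ∈ Metric.closedBall z₀ ρ
  · refine le_trans ?_ (le_max_left _ _)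
    rw [div_le_iff₀ hpos]
    exact (convex_closedBall z₀ ρ).norm_image_sub_le_of_norm_deriv_le
      (fun w hw => hF.differentiableAt (hD.mem_nhds (hρD hw))) hM₃ hz' hζρ
  · refine le_trans ?_ (le_max_right _ _)
    refine div_le_div₀ ?_ ((norm_sub_le _ _).trans (add_le_add (hM₂ ζ hζ) (hM₁ z hz')))
      (half_pos hρ) ?_
    · exact add_nonneg ((norm_nonneg _).trans (hM₂ ζ hζ)) ((norm_nonneg _).trans (hM₁ z hz'))
    · rw [Metric.mem_closedBall, not_le] at hζρ
      rw [← dist_eq_norm]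
      linarith [dist_triangle ζ z z₀, Metric.mem_ball.1 hz]

section

variable {a : ℂ} {Γ : Path a a}

theorem differentiableOn_contourIntegral_dslope
    (hΓ : AbsolutelyContinuousOnInterval Γ.extend 0 1) {D : Set ℂ} (hD : IsOpen D) {F : ℂ → ℂ}
    (hF : DifferentiableOn ℂ F D) (hΓD : range Γ ⊆ D) :
    DifferentiableOn ℂ (fun z => contourIntegral Γ (dslope F z)) D := by
  intro z₀ hz₀
  obtain ⟨r, hr, C, hrD, hC⟩ :=
    exists_dslope_bound hD hF (isCompact_range Γ.continuous) hΓD hz₀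
  have hds : ∀ w ∈ D, DifferentiableOn ℂ (dslope F w) D := fun w hw =>
    (Complex.differentiableOn_dslope (hD.mem_nhds hw)).2 hF
  refine (hasDerivAt_contourIntegral hΓ hr (fun ζ hζ => ?_)
    (fun z hz => (hds z (hrD hz)).continuousOn.mono hΓD)
    hC).differentiableAt.differentiableWithinAt
  simpa only [dslope_comm F _ ζ] using (hds ζ (hΓD hζ)).mono hrD

theorem contourIntegral_dslope (hΓ : AbsolutelyContinuousOnInterval Γ.extend 0 1) {F : ℂ → ℂ}
    (hF : ContinuousOn F (range Γ)) {z : ℂ} (hz : z ∉ range Γ) :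
    contourIntegral Γ (dslope F z) = contourIntegral Γ (fun ζ => F ζ / (ζ - z)) -
      F z * contourIntegral Γ (fun ζ => 1 / (ζ - z)) := by
  rw [← contourIntegral_const_mul, ← contourIntegral_sub
    (contourIntegrable_of_continuousOn hΓ (continuousOn_div_sub hF hz))
    (contourIntegrable_of_continuousOn (f := fun ζ => F z * (1 / (ζ - z))) hΓ
      (continuousOn_const.mul (continuousOn_div_sub continuousOn_const hz)))]
  refine contourIntegral_congr fun ζ hζ => ?_
  have hne : ζ ≠ z := fun h => hz (h ▸ hζ)
  rw [dslope_of_ne _ hne, slope_def_field]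
  ring

/-- Dixon's argument. The integral of the difference quotient over the curve is holomorphic in `D`;
outside the curve, where the winding number vanishes, it agrees with the Cauchy transform of `F`.
The two glue to an entire function that vanishes at infinity, hence everywhere. -/
theorem contourIntegral_dslope_eq_zero (hΓ : AbsolutelyContinuousOnInterval Γ.extend 0 1)
    {D : Set ℂ} (hD : IsOpen D) {F : ℂ → ℂ} (hF : DifferentiableOn ℂ F D) (hΓD : range Γ ⊆ D)
    (hin : curveInside Γ ⊆ D) {z : ℂ} (hz : z ∈ D) : contourIntegral Γ (dslope F z) = 0 := by
  classical
  have hFΓ : ContinuousOn F (range Γ) := hF.continuousOn.mono hΓD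
  set E : Set ℂ := {w | w ∉ range Γ ∧
    ¬ Bornology.IsBounded (connectedComponentIn (range Γ)ᶜ w)}
  set H : ℂ → ℂ := fun w => if w ∈ D then contourIntegral Γ (dslope F w) else
    contourIntegral Γ (fun ζ => F ζ / (ζ - w))
  have hHD : EqOn H (fun w => contourIntegral Γ (dslope F w)) D := fun w hw => if_pos hw
  have hHE : EqOn H (fun w => contourIntegral Γ (fun ζ => F ζ / (ζ - w))) E := fun w hw => by
    by_cases hwD : w ∈ D
    · rw [hHD hwD]
      simp only
      rw [contourIntegral_dslope hΓ hFΓ hw.1, contourIntegral_inv_sub_eq_zero hΓ hw.2, mul_zero,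
        sub_zero]
    · exact if_neg hwD
  have hE : IsOpen E := by
    rw [isOpen_iff_mem_nhds]
    intro w hw
    filter_upwards [(isOpen_compl_range Γ).connectedComponentIn.mem_nhds
      (mem_connectedComponentIn hw.1)] with u hu
    exact ⟨connectedComponentIn_subset _ _ hu, connectedComponentIn_eq hu ▸ hw.2⟩
  have hHdiff : Differentiable ℂ H := fun w => by
    by_cases hwD : w ∈ D
    · exact (((differentiableOn_contourIntegral_dslope hΓ hD hF hΓD).congr hHD).differentiableAt
        (hD.mem_nhds hwD))
    · -- the bounded components of the complement make up the inside, which is part of `D`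
      have hwE : w ∈ E := ⟨fun h => hwD (hΓD h), fun h => hwD (hin ⟨fun h => hwD (hΓD h), h⟩)⟩
      exact ((hasDerivAt_cauchyTransform hΓ hFΓ hwE.1).congr_of_eventuallyEq
        (hHE.eventuallyEq_of_mem (hE.mem_nhds hwE))).differentiableAt
  have hlim : Tendsto H (cocompact ℂ) (𝓝 0) :=
    (tendsto_cauchyTransform hΓ hFΓ).congr'
      ((eventually_not_isBounded_component Γ).mono fun w hw => (hHE hw).symm)
  rw [← hHdiff.apply_eq_of_tendsto_cocompact z hlim]
  exact (hHD hz).symm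

end

/-! ### Rational functions with poles inside the curve -/

section

variable {a : ℂ} {Γ : Path a a} {s : Multiset ℂ}

theorem prod_sub_ne_zero (hs : ∀ w ∈ s, w ∉ range Γ) {ζ : ℂ} (hζ : ζ ∈ range Γ) :
    (s.map fun w => ζ - w).prod ≠ 0 := by
  rw [Ne, Multiset.prod_eq_zero_iff, Multiset.mem_map]
  rintro ⟨w, hw, h⟩
  exact hs w hw (sub_eq_zero.1 h ▸ hζ)

theorem continuousOn_div_prod_sub {φ : ℂ → ℂ} (hφ : ContinuousOn φ (range Γ))
    (hs : ∀ w ∈ s, w ∉ range Γ) :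
    ContinuousOn (fun ζ => φ ζ / (s.map fun w => ζ - w).prod) (range Γ) := by
  refine hφ.div (Continuous.continuousOn ?_) fun ζ hζ => prod_sub_ne_zero hs hζ
  exact continuous_multiset_prod s fun w _ => by fun_prop

/-- If the curve winds equally often around all poles, the reciprocal of a product of at least two
linear factors has integral zero: two distinct poles are separated by partial fractions, and a
single multiple pole leaves a primitive. -/
theorem contourIntegral_inv_prod_eq_zero (hΓ : AbsolutelyContinuousOnInterval Γ.extend 0 1)
    {κ : ℂ} (n : ℕ) : ∀ s : Multiset ℂ, s.card = n + 2 → (∀ w ∈ s, w ∉ range Γ) →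
    (∀ w ∈ s, contourIntegral Γ (fun ζ => 1 / (ζ - w)) = κ) →
    contourIntegral Γ (fun ζ => 1 / (s.map fun w => ζ - w).prod) = 0 := by
  induction n with
  | zero =>
    intro s hcard hs hκ
    obtain ⟨u, v, rfl⟩ := Multiset.card_eq_two.1 hcard
    have hu : u ∉ range Γ := hs u (by simp)
    have hv : v ∉ range Γ := hs v (by simp)
    by_cases huv : u = v
    · subst huv
      simpa [pow_two] using contourIntegral_inv_pow_eq_zero hΓ hu 0
    · have huv' : u - v ≠ 0 := sub_ne_zero.2 huv
      rw [contourIntegral_congr (g := fun ζ => (u - v)⁻¹ * (1 / (ζ - u) - 1 / (ζ - v))),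
        contourIntegral_const_mul, contourIntegral_sub
        (contourIntegrable_of_continuousOn hΓ (continuousOn_div_sub continuousOn_const hu))
        (contourIntegrable_of_continuousOn hΓ (continuousOn_div_sub continuousOn_const hv)),
        hκ u (by simp), hκ v (by simp), sub_self, mul_zero]
      intro ζ hζ
      have h1 : ζ - u ≠ 0 := sub_ne_zero.2 fun h => hu (h ▸ hζ)
      have h2 : ζ - v ≠ 0 := sub_ne_zero.2 fun h => hv (h ▸ hζ)
      simp only [Multiset.insert_eq_cons, Multiset.map_cons, Multiset.map_singleton,
        Multiset.prod_cons, Multiset.prod_singleton]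
      field_simp
      ring
  | succ n ih =>
    intro s hcard hs hκ
    obtain ⟨u, hu⟩ := Multiset.card_pos_iff_exists_mem.1 (by omega : 0 < s.card)
    obtain ⟨s', rfl⟩ := Multiset.exists_cons_of_mem hu
    by_cases hall : ∀ v ∈ s', v = u
    · rw [Multiset.eq_replicate_card.2 hall]
      rw [Multiset.card_cons] at hcard
      have hc : s'.card = n + 2 := by omega
      simpa [hc, ← pow_succ'] using
        contourIntegral_inv_pow_eq_zero hΓ (hs u (by simp)) (n + 1)
    · push Not at hall
      obtain ⟨v, hv, hvu⟩ := hall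
      obtain ⟨r, rfl⟩ := Multiset.exists_cons_of_mem hv
      have huv' : u - v ≠ 0 := sub_ne_zero.2 (Ne.symm hvu)
      simp only [Multiset.card_cons] at hcard
      have hsub : ∀ x, x = u ∨ x = v → ∀ w ∈ x ::ₘ r, w ∈ u ::ₘ v ::ₘ r := by
        intro x hx w hw
        simp only [Multiset.mem_cons] at hw ⊢
        rcases hw with rfl | hw <;> tauto
      have hzero : ∀ x, x = u ∨ x = v →
          contourIntegral Γ (fun ζ => 1 / ((x ::ₘ r).map fun w => ζ - w).prod) = 0 :=
        fun x hx => ih _ (by rw [Multiset.card_cons]; omega)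
          (fun w hw => hs w (hsub x hx w hw)) fun w hw => hκ w (hsub x hx w hw)
      have hint : ∀ x, x = u ∨ x = v → ContourIntegrable Γ
          (fun ζ => 1 / ((x ::ₘ r).map fun w => ζ - w).prod) := fun x hx =>
        contourIntegrable_of_continuousOn hΓ
          (continuousOn_div_prod_sub continuousOn_const fun w hw => hs w (hsub x hx w hw))
      rw [contourIntegral_congr (g := fun ζ => (u - v)⁻¹ *
          (1 / ((u ::ₘ r).map fun w => ζ - w).prod - 1 / ((v ::ₘ r).map fun w => ζ - w).prod)),
        contourIntegral_const_mul, contourIntegral_sub (hint u (.inl rfl)) (hint v (.inr rfl)),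
        hzero u (.inl rfl), hzero v (.inr rfl), sub_self, mul_zero]
      intro ζ hζ
      have h1 : ζ - u ≠ 0 := sub_ne_zero.2 fun h => hs u (by simp) (h ▸ hζ)
      have h2 : ζ - v ≠ 0 := sub_ne_zero.2 fun h => hs v (by simp) (h ▸ hζ)
      have h3 : (r.map fun w => ζ - w).prod ≠ 0 :=
        prod_sub_ne_zero (fun w hw => hs w (hsub u (.inl rfl) w (by simp [hw]))) hζ
      simp only [Multiset.map_cons, Multiset.prod_cons]
      field_simp
      ring

/-- A rational function that decays at infinity like `1 / ζ ^ 2` has integral zero along a curve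
that winds equally often around all its poles. -/
theorem contourIntegral_polynomial_div_prod_eq_zero
    (hΓ : AbsolutelyContinuousOnInterval Γ.extend 0 1) {κ : ℂ} :
    ∀ (s : Multiset ℂ) (p : Polynomial ℂ), p.natDegree + 2 ≤ s.card → (∀ w ∈ s, w ∉ range Γ) →
    (∀ w ∈ s, contourIntegral Γ (fun ζ => 1 / (ζ - w)) = κ) →
    contourIntegral Γ (fun ζ => p.eval ζ / (s.map fun w => ζ - w).prod) = 0 := by
  intro s
  induction s using Multiset.induction_on with
  | empty => intro p hp; simp at hp
  | cons w s ih =>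
    intro p hp hs hκ
    -- write `p = p(w) + (X - w) * q`; the quotient `q` goes with one pole less
    have h0 : contourIntegral Γ (fun ζ => p.eval w * (1 / ((w ::ₘ s).map fun w => ζ - w).prod))
        = 0 := by
      rw [contourIntegral_const_mul, contourIntegral_inv_prod_eq_zero hΓ ((w ::ₘ s).card - 2)
        _ (by omega) hs hκ, mul_zero]
    by_cases hdeg : p.natDegree = 0
    · obtain ⟨c, rfl⟩ := Polynomial.natDegree_eq_zero.1 hdeg
      simpa only [Polynomial.eval_C, mul_one_div] using h0
    set q := p /ₘ (Polynomial.X - Polynomial.C w) with hq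
    have hqdeg : q.natDegree = p.natDegree - 1 := by
      rw [hq, Polynomial.natDegree_divByMonic _ (Polynomial.monic_X_sub_C w),
        Polynomial.natDegree_X_sub_C]
    have hpq : ∀ ζ, p.eval ζ = p.eval w + (ζ - w) * q.eval ζ := fun ζ => by
      conv_lhs => rw [← Polynomial.modByMonic_add_div p (Polynomial.X - Polynomial.C w),
        Polynomial.modByMonic_X_sub_C_eq_C_eval]
      simp [hq]
    have hs' : ∀ v ∈ s, v ∉ range Γ := fun v hv => hs v (Multiset.mem_cons_of_mem hv)
    have h1 := ih q (by rw [Multiset.card_cons] at hp; omega) hs'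
      fun v hv => hκ v (Multiset.mem_cons_of_mem hv)
    rw [contourIntegral_congr (g := fun ζ =>
        p.eval w * (1 / ((w ::ₘ s).map fun w => ζ - w).prod) +
          q.eval ζ / (s.map fun w => ζ - w).prod),
      contourIntegral_add (contourIntegrable_of_continuousOn
          (f := fun ζ => p.eval w * (1 / ((w ::ₘ s).map fun w => ζ - w).prod)) hΓ
          (continuousOn_const.mul (continuousOn_div_prod_sub continuousOn_const hs)))
        (contourIntegrable_of_continuousOn hΓ
          (continuousOn_div_prod_sub q.continuous.continuousOn hs')), h0, h1, add_zero]
    intro ζ hζ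
    have h2 : ζ - w ≠ 0 := sub_ne_zero.2 fun h => hs w (by simp) (h ▸ hζ)
    have h3 := prod_sub_ne_zero hs' hζ
    simp only [Multiset.map_cons, Multiset.prod_cons, hpq ζ]
    field_simp

end

/-! ### Hermite interpolation -/

/-- Newton interpolation: splitting off one node at a time by difference quotients writes `F` as a
polynomial plus a multiple of the node polynomial, with holomorphic cofactor. -/
theorem exists_newton_expansion {D : Set ℂ} (hD : IsOpen D) (s : Multiset ℂ) :
    (∀ w ∈ s, w ∈ D) → ∀ F : ℂ → ℂ, DifferentiableOn ℂ F D →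
    ∃ (f : Polynomial ℂ) (G : ℂ → ℂ), f.degree < (s.card : WithBot ℕ) ∧ DifferentiableOn ℂ G D ∧
      ∀ z, F z = f.eval z + (s.map fun w => z - w).prod * G z := by
  induction s using Multiset.induction_on with
  | empty => exact fun _ F hF => ⟨0, F, by simp, hF, by simp⟩
  | cons w s ih =>
    intro hs F hF
    obtain ⟨f, G, hf, hG, h⟩ := ih (fun v hv => hs v (Multiset.mem_cons_of_mem hv)) (dslope F w)
      ((Complex.differentiableOn_dslope (hD.mem_nhds (hs w (by simp)))).2 hF)
    refine ⟨Polynomial.C (F w) + (Polynomial.X - Polynomial.C w) * f, G, ?_, hG, fun z => ?_⟩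
    · rw [Multiset.card_cons]
      refine (Polynomial.degree_add_le _ _).trans_lt (max_lt ?_ ?_)
      · exact Polynomial.degree_C_le.trans_lt (by exact_mod_cast s.card.succ_pos)
      · by_cases hf0 : f = 0
        · simp only [hf0, mul_zero, Polynomial.degree_zero]
          exact WithBot.bot_lt_coe _
        · rw [Polynomial.degree_mul, Polynomial.degree_X_sub_C]
          rw [Polynomial.degree_eq_natDegree hf0] at hf ⊢
          have : f.natDegree < s.card := by exact_mod_cast hf
          exact_mod_cast (by omega : 1 + f.natDegree < s.card + 1)
    · have h1 := sub_smul_dslope F w z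
      rw [h z, smul_eq_mul] at h1
      simp only [Polynomial.eval_add, Polynomial.eval_C, Polynomial.eval_mul, Polynomial.eval_sub,
        Polynomial.eval_X, Multiset.map_cons, Multiset.prod_cons]
      linear_combination -h1

section

variable {l : ℕ} {F : ℂ → ℂ} {γ : Fin l → ℂ} {t : Fin l → ℕ}

/-- The nodes `γ j`, each repeated `t j` times. -/
def nodes (γ : Fin l → ℂ) (t : Fin l → ℕ) : Multiset ℂ :=
  ∑ j, Multiset.replicate (t j) (γ j)

theorem card_nodes (γ : Fin l → ℂ) (t : Fin l → ℕ) : (nodes γ t).card = ∑ j, t j := by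
  simp [nodes]

theorem exists_eq_of_mem_nodes {w : ℂ} (hw : w ∈ nodes γ t) : ∃ j, w = γ j := by
  obtain ⟨j, -, hj⟩ := Multiset.mem_sum.1 hw
  exact ⟨j, Multiset.eq_of_mem_replicate hj⟩

theorem prod_nodes (γ : Fin l → ℂ) (t : Fin l → ℕ) (z : ℂ) :
    ((nodes γ t).map fun w => z - w).prod = ∏ j, (z - γ j) ^ t j := by
  rw [nodes, ← Multiset.coe_mapAddMonoidHom, map_sum, Multiset.prod_sum]
  simp

theorem isHermiteInterpolant_of_eq_add_mul {D : Set ℂ} (hD : IsOpen D) (hγ : ∀ j, γ j ∈ D)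
    (hF : DifferentiableOn ℂ F D) {f : Polynomial ℂ} {G : ℂ → ℂ}
    (hf : f.degree < ((∑ j, t j : ℕ) : WithBot ℕ)) (hG : DifferentiableOn ℂ G D)
    (h : ∀ z, F z = f.eval z + (∏ j, (z - γ j) ^ t j) * G z) : IsHermiteInterpolant F γ t f := by
  refine ⟨hf, fun j i hi => ?_⟩
  have hFa : AnalyticAt ℂ F (γ j) := hF.analyticAt (hD.mem_nhds (hγ j))
  have hfa : AnalyticAt ℂ (fun x => f.eval x) (γ j) :=
    f.differentiable.analyticAt _
  have hGa : AnalyticAt ℂ G (γ j) := hG.analyticAt (hD.mem_nhds (hγ j))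
  have hord : (t j : ℕ∞) ≤ analyticOrderAt (F - fun x => f.eval x) (γ j) := by
    rw [natCast_le_analyticOrderAt (hFa.sub hfa)]
    refine ⟨fun z => (∏ k ∈ Finset.univ.erase j, (z - γ k) ^ t k) * G z,
      AnalyticAt.mul (by fun_prop) hGa, Eventually.of_forall fun z => ?_⟩
    rw [Pi.sub_apply, h z, ← Finset.mul_prod_erase _ _ (Finset.mem_univ j), smul_eq_mul]
    ring
  have hz := (natCast_le_analyticOrderAt_iff_iteratedDeriv_eq_zero (hFa.sub hfa)).1 hord i hi
  rw [iteratedDeriv_sub hFa.contDiffAt hfa.contDiffAt] at hz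
  exact (sub_eq_zero.1 hz).symm

theorem iteratedDeriv_polynomial_eval (n : ℕ) (p : Polynomial ℂ) :
    iteratedDeriv n (fun x => p.eval x) = fun x => (Polynomial.derivative^[n] p).eval x := by
  induction n generalizing p with
  | zero => simp
  | succ n ih =>
    have h : deriv (fun x => p.eval x) = fun x => p.derivative.eval x := funext fun _ => p.deriv
    rw [iteratedDeriv_succ', h, ih, Function.iterate_succ_apply]

theorem isHermiteInterpolant_unique (hγ : Function.Injective γ) {f g : Polynomial ℂ}
    (hf : IsHermiteInterpolant F γ t f) (hg : IsHermiteInterpolant F γ t g) : f = g := by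
  by_contra hne
  have h0 : f - g ≠ 0 := sub_ne_zero.2 hne
  have hdvd : ∀ j, (Polynomial.X - Polynomial.C (γ j)) ^ t j ∣ f - g := fun j => by
    rw [← Polynomial.le_rootMultiplicity_iff h0]
    rcases Nat.eq_zero_or_pos (t j) with ht | ht
    · simp [ht]
    have := (Polynomial.lt_rootMultiplicity_iff_isRoot_iterate_derivative h0 (t := γ j)
      (n := t j - 1)).2 fun m hm => by
        have h1 := (hf.2 j m (by omega)).trans (hg.2 j m (by omega)).symm
        simp only [iteratedDeriv_polynomial_eval] at h1
        rw [Polynomial.iterate_derivative_sub, Polynomial.IsRoot, Polynomial.eval_sub, h1, sub_self]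
    omega
  have hprod : ∏ j, (Polynomial.X - Polynomial.C (γ j)) ^ t j ∣ f - g :=
    Finset.prod_dvd_of_coprime (fun i _ j _ hij =>
      (Polynomial.pairwise_coprime_X_sub_C hγ hij).pow) fun j _ => hdvd j
  have hle := Polynomial.degree_le_of_dvd hprod h0
  rw [Polynomial.degree_prod] at hle
  simp only [Polynomial.degree_pow, Polynomial.degree_X_sub_C, nsmul_eq_mul, mul_one] at hle
  have hlt := (Polynomial.degree_sub_le f g).trans_lt (max_lt hf.1 hg.1)
  rw [Nat.cast_sum] at hlt
  exact absurd hle (not_le.2 hlt)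

end

/-! ### The integral formula for the interpolant -/

section

variable {a : ℂ} {Γ : Path a a} {D : Set ℂ} {F : ℂ → ℂ}

theorem contourIntegral_inv_sub_of_mem_inside (hΓ : IsPositiveSimpleClosedCurve Γ) {w : ℂ}
    (hw : w ∈ curveInside Γ) :
    contourIntegral Γ (fun ζ => 1 / (ζ - w)) = 2 * Real.pi * Complex.I := by
  have h := hΓ.positive w hw
  rw [windingNumber, one_div, inv_mul_eq_one₀ Complex.two_pi_I_ne_zero] at h
  exact h.symm

/-- Cauchy's integral formula, obtained by splitting the vanishing integral of the difference
quotient. -/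
theorem contourIntegral_cauchy (hΓ : IsPositiveSimpleClosedCurve Γ) (hD : IsOpen D)
    (hF : DifferentiableOn ℂ F D) (hΓD : range Γ ⊆ D) (hin : curveInside Γ ⊆ D) {z : ℂ}
    (hz : z ∈ curveInside Γ) :
    contourIntegral Γ (fun ζ => F ζ / (ζ - z)) = 2 * Real.pi * Complex.I * F z := by
  have h := contourIntegral_dslope_eq_zero hΓ.absolutelyContinuous hD hF hΓD hin (hin hz)
  rw [contourIntegral_dslope hΓ.absolutelyContinuous (hF.continuousOn.mono hΓD) hz.1,
    contourIntegral_inv_sub_of_mem_inside hΓ hz] at h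
  linear_combination h

/-- Only the cofactor `G` of the node polynomial contributes to the integral of the kernel: the
part coming from `f` is a rational function decaying like `1 / ζ ^ 2`. -/
theorem contourIntegral_hermiteKernel (hΓ : IsPositiveSimpleClosedCurve Γ) (hD : IsOpen D)
    (hΓD : range Γ ⊆ D) (hin : curveInside Γ ⊆ D) {l : ℕ} {γ : Fin l → ℂ} {t : Fin l → ℕ}
    (hγ : ∀ j, γ j ∈ curveInside Γ) {f : Polynomial ℂ} {G : ℂ → ℂ}
    (hf : f.degree < ((∑ j, t j : ℕ) : WithBot ℕ)) (hG : DifferentiableOn ℂ G D)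
    (h : ∀ z, F z = f.eval z + (∏ j, (z - γ j) ^ t j) * G z) {z : ℂ}
    (hz : z ∈ curveInside Γ) :
    ContourIntegrable Γ (hermiteKernel F γ t z) ∧
      contourIntegral Γ (hermiteKernel F γ t z) =
        -(2 * Real.pi * Complex.I * ((∏ j, (z - γ j) ^ t j) * G z)) := by
  have hac := hΓ.absolutelyContinuous
  set s : Multiset ℂ := z ::ₘ nodes γ t with hs
  have hsin : ∀ w ∈ s, w ∈ curveInside Γ := fun w hw => by
    rcases Multiset.mem_cons.1 hw with rfl | hw
    · exact hz
    · obtain ⟨j, rfl⟩ := exists_eq_of_mem_nodes hw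
      exact hγ j
  have hsΓ : ∀ w ∈ s, w ∉ range Γ := fun w hw => (hsin w hw).1
  have hc1 : ContinuousOn (fun ζ => f.eval ζ / (s.map fun w => ζ - w).prod) (range Γ) :=
    continuousOn_div_prod_sub f.continuous.continuousOn hsΓ
  have hc2 : ContinuousOn (fun ζ => G ζ / (ζ - z)) (range Γ) :=
    continuousOn_div_sub (hG.continuousOn.mono hΓD) hz.1
  have hEq : EqOn (hermiteKernel F γ t z) (fun ζ => -(∏ j, (z - γ j) ^ t j) *
      (f.eval ζ / (s.map fun w => ζ - w).prod + G ζ / (ζ - z))) (range Γ) := by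
    intro ζ hζ
    have h1 : ζ - z ≠ 0 := sub_ne_zero.2 fun h => hz.1 (h ▸ hζ)
    have h2 : ∏ j, (ζ - γ j) ^ t j ≠ 0 := Finset.prod_ne_zero_iff.2 fun j _ =>
      pow_ne_zero _ (sub_ne_zero.2 fun h => (hγ j).1 (h ▸ hζ))
    simp only [hermiteKernel, div_pow, Finset.prod_div_distrib, hs, Multiset.map_cons,
      Multiset.prod_cons, prod_nodes, h ζ]
    rw [← neg_sub ζ z]
    field_simp
  refine ⟨contourIntegrable_of_continuousOn hac
    ((continuousOn_const.mul (hc1.add hc2)).congr hEq), ?_⟩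
  have hzero : contourIntegral Γ (fun ζ => f.eval ζ / (s.map fun w => ζ - w).prod) = 0 := by
    by_cases hf0 : f = 0
    · simp [hf0, contourIntegral_eq]
    · refine contourIntegral_polynomial_div_prod_eq_zero hac s f ?_ hsΓ fun w hw =>
        contourIntegral_inv_sub_of_mem_inside hΓ (hsin w hw)
      rw [Polynomial.degree_eq_natDegree hf0] at hf
      have : f.natDegree < ∑ j, t j := by exact_mod_cast hf
      rw [hs, Multiset.card_cons, card_nodes]
      omega
  rw [contourIntegral_congr hEq, contourIntegral_const_mul, contourIntegral_add
    (contourIntegrable_of_continuousOn hac hc1) (contourIntegrable_of_continuousOn hac hc2),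
    hzero, contourIntegral_cauchy hΓ hD hG hΓD hin hz]
  ring

end

end HermiteContour

theorem mainTheorem4 (D : Set ℂ) (hD_open : IsOpen D) (hD_conn : IsConnected D)
    (F : ℂ → ℂ) (hF : AnalyticOnNhd ℂ F D)
    (l : ℕ) (γ : Fin l → ℂ) (hγ : Function.Injective γ)
    (t : Fin l → ℕ) (ht : ∀ j, 0 < t j)
    {a : ℂ} (Γ : Path a a) (hΓ : IsPositiveSimpleClosedCurve Γ)
    (hΓD : Set.range Γ ⊆ D) (hinsideD : curveInside Γ ⊆ D)
    (hγΓ : ∀ j, γ j ∈ curveInside Γ) :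
    (∃! f : Polynomial ℂ, IsHermiteInterpolant F γ t f) ∧
      ∀ f : Polynomial ℂ, IsHermiteInterpolant F γ t f →
        ∀ z ∈ curveInside Γ,
          ContourIntegrable Γ (hermiteKernel F γ t z) ∧
            f.eval z = F z + (1 / (2 * Real.pi * Complex.I)) *
              contourIntegral Γ (hermiteKernel F γ t z) := by
  have hFd : DifferentiableOn ℂ F D := hF.differentiableOn
  have hγD : ∀ j, γ j ∈ D := fun j => hinsideD (hγΓ j)
  obtain ⟨f₀, G, hdeg, hG, hnewton⟩ := HermiteContour.exists_newton_expansion hD_open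
    (HermiteContour.nodes γ t) (fun w hw => by
      obtain ⟨j, rfl⟩ := HermiteContour.exists_eq_of_mem_nodes hw
      exact hγD j) F hFd
  rw [HermiteContour.card_nodes] at hdeg
  simp only [HermiteContour.prod_nodes] at hnewton
  have hf₀ := HermiteContour.isHermiteInterpolant_of_eq_add_mul hD_open hγD hFd hdeg hG hnewton
  refine ⟨⟨f₀, hf₀, fun g hg => HermiteContour.isHermiteInterpolant_unique hγ hg hf₀⟩,
    fun f hf z hz => ?_⟩
  obtain rfl := HermiteContour.isHermiteInterpolant_unique hγ hf hf₀
  obtain ⟨hint, hval⟩ := HermiteContour.contourIntegral_hermiteKernel hΓ hD_open hΓD hinsideD hγΓ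
    hdeg hG hnewton hz
  refine ⟨hint, ?_⟩
  have hpi := Complex.two_pi_I_ne_zero
  rw [hval, hnewton z]
  field_simp
  ring
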